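/- A real random variable $X$ is called symmetric $\alpha$-stable with scale parameter $\sigma\ge 0$, written $X\sim S_\alpha(\sigma)$, if $\mathbb E e^{i\theta X}=e^{-\sigma^\alpha|\theta|^\alpha}$ for all $\theta\in\mathbb R$. A real process is S$\alpha$S if all finite linear combinations of its values are symmetric $\alpha$-stable. A process $(X_t)_{t\ge 0}$ is self-similar with exponent $H$ if for every $c>0$ the processes $(X_{ct})_{t\ge0}$ and $(c^H X_t)_{t\ge0}$ have the same finite-dimensional distributions, and it has stationary increments if for every $h\ge0$ the processes $(X_{t+h}-X_h)_{t\ge0}$ and $(X_t-X_0)_{t\ge0}$ have the same finite-dimensional distributions. An S$\alpha$S random measure $M$ with control measure $m$ assigns to every measurable set $E$ with $m(E)<\infty$ a random variable $M(E)\sim S_\alpha(m(E)^{1/\alpha})$, such that the values on finitely many pairwise disjoint sets are independent, and $M(\bigcup_i E_i)=\sum_i M(E_i)$ almost surely (as a convergent series) for every sequence of pairwise disjoint measurable sets with $m(\bigcup_i E_i)<\infty$. For $f\in L^\alpha(m)$, the integral $\int f\,dM$ is the random variable $X$ such that $\int f_n\,dM\to X$ in probability for every sequence of simple functions $f_n\in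 L^\alpha(m)$ with $\int|f_n-f|^\alpha\,dm\to0$; here $\int g\,dM=\sum_y y\,M(g=y)$ for a simple function $g\in L^\alpha(m)$, the sum being over the finitely many non-zero values $y$ of $g$. Theorem. Let $0<\alpha\le 2$, $1<\beta\le 2$ and $0<H'<1$. Let $(A_t)_{t\ge 0}$ be a non-degenerate (i.e. its values are not all almost surely constant) S$\beta$S process on a probability space $(\Omega',\mathcal F',P')$ that is self-similar with exponent $H'$ and has stationary increments. Let $M$ be an S$\alpha$S random measure on $\Omega'\times\mathbb R$ with control measure $P'\times\lambda$, where $\lambda$ is Lebesgue measure, defined on a probability space $(\Omega,\mathcal F,P)$. Then the indicator fractional stable motion $$Y(t)=\int_{\Omega'}\int_{\mathbb R}1_{[0,A_t(\omega')]}(x)\,M(d\omega',dx),\qquad t\ge 0,$$ where $[0,a]$ means $[a,0]$ if $a<0$, is well defined: for every $t\ge 0$ the integrand belongs to $L^\alpha(P'\times\lambda)$, and the integral exists and is unique up to almost sure equality. Moreover, $Y$ is an S$\alpha$S process that is self-similar with exponent $H=H'/\alpha$ and has stationary increments. -/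

import Mathlib

open MeasureTheory ProbabilityTheory Filter Topology
open scoped NNReal ENNReal

namespace IFSM

/-- `X` is a symmetric `α`-stable random variable with scale parameter `σ`, that is
`X ∼ S_α(σ)`: its characteristic function is `θ ↦ exp (-σ^α |θ|^α)`. -/
def HasSaSLaw {Ω : Type*} [MeasurableSpace Ω] (α σ : ℝ) (X : Ω → ℝ) (P : Measure Ω) : Prop :=
  AEMeasurable X P ∧
    ∀ θ : ℝ, charFun (P.map X) θ = ((Real.exp (-(σ ^ α * |θ| ^ α)) : ℝ) : ℂ)

/-- A symmetric `α`-stable process: every finite linear combination of its values is a symmetric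
`α`-stable random variable (of some scale `σ ≥ 0`). -/
def IsSaSProcess {Ω T : Type*} [MeasurableSpace Ω] (α : ℝ) (X : T → Ω → ℝ) (P : Measure Ω) :
    Prop :=
  ∀ (I : Finset T) (c : T → ℝ), ∃ σ : ℝ, 0 ≤ σ ∧
    HasSaSLaw α σ (fun ω => ∑ t ∈ I, c t * X t ω) P

/-- Two processes with the same index set have the same finite-dimensional distributions. -/
def SameFDD {Ω Ω' T : Type*} [MeasurableSpace Ω] [MeasurableSpace Ω']
    (X : T → Ω → ℝ) (P : Measure Ω) (Y : T → Ω' → ℝ) (Q : Measure Ω') : Prop :=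
  ∀ I : Finset T, IdentDistrib (fun ω (t : I) => X t ω) (fun ω (t : I) => Y t ω) P Q

/-- Self-similarity with exponent `H`: `(X_{ct})_{t ≥ 0}` and `(c^H X_t)_{t ≥ 0}` have the same
finite-dimensional distributions, for every `c > 0`. -/
def IsSelfSimilar {Ω : Type*} [MeasurableSpace Ω] (H : ℝ) (X : ℝ≥0 → Ω → ℝ) (P : Measure Ω) :
    Prop :=
  ∀ c : ℝ≥0, 0 < c → SameFDD (fun t => X (c * t)) P (fun t ω => (c : ℝ) ^ H * X t ω) P

/-- Stationary increments: `(X_{t+h} - X_h)_{t ≥ 0}` and `(X_t - X_0)_{t ≥ 0}` have the same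
finite-dimensional distributions, for every `h ≥ 0`. -/
def HasStationaryIncrements {Ω : Type*} [MeasurableSpace Ω] (X : ℝ≥0 → Ω → ℝ) (P : Measure Ω) :
    Prop :=
  ∀ h : ℝ≥0, SameFDD (fun t ω => X (t + h) ω - X h ω) P (fun t ω => X t ω - X 0 ω) P

/-- A symmetric `α`-stable, self-similar process with stationary increments, of self-similarity
exponent `H`. -/
structure IsSaSSSSI {Ω : Type*} [MeasurableSpace Ω] (α H : ℝ) (X : ℝ≥0 → Ω → ℝ)
    (P : Measure Ω) : Prop where
  stable : IsSaSProcess α X P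
  selfSimilar : IsSelfSimilar H X P
  stationaryIncrements : HasStationaryIncrements X P

/-- A process is non-degenerate if its values are not all almost surely constant. -/
def IsNondegenerate {Ω T : Type*} [MeasurableSpace Ω] (X : T → Ω → ℝ) (P : Measure Ω) : Prop :=
  ∃ t, ¬ ∃ c : ℝ, X t =ᵐ[P] fun _ => c

/-- `M` is a symmetric `α`-stable random measure with control measure `m`. Only its values on the
measurable sets of finite `m`-measure matter. The series in the `σ`-additivity property is an
almost surely convergent series (limit of partial sums). -/
structure IsSaSRandomMeasure {B Ω : Type*} [MeasurableSpace B] [MeasurableSpace Ω] (α : ℝ)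
    (m : Measure B) (M : Set B → Ω → ℝ) (P : Measure Ω) : Prop where
  law : ∀ E, MeasurableSet E → m E < ∞ → HasSaSLaw α (m.real E ^ (1 / α)) (M E) P
  indep : ∀ (n : ℕ) (E : Fin n → Set B), (∀ i, MeasurableSet (E i)) → (∀ i, m (E i) < ∞) →
    Pairwise (fun i j => Disjoint (E i) (E j)) → iIndepFun (fun i => M (E i)) P
  sigmaAdditive : ∀ E : ℕ → Set B, (∀ i, MeasurableSet (E i)) → m (⋃ i, E i) < ∞ →
    Pairwise (fun i j => Disjoint (E i) (E j)) →
    ∀ᵐ ω ∂P, Tendsto (fun n => ∑ i ∈ Finset.range n, M (E i) ω) atTop (𝓝 (M (⋃ i, E i) ω))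

/-- The integral `∑ y, y · M(f = y)` of a simple function `f` against `M`. For `f` in `L^α(m)` all
sets `{f = y}` with `y ≠ 0` have finite measure; the term `y = 0` vanishes. -/
noncomputable def simpleIntegral {B Ω : Type*} [MeasurableSpace B] (M : Set B → Ω → ℝ)
    (f : SimpleFunc B ℝ) : Ω → ℝ :=
  fun ω => ∑ y ∈ f.range, y * M (f ⁻¹' {y}) ω

/-- The random variable `X` is (a version of) the stochastic integral `∫ f dM`: the integrand `f`
is in `L^α(m)`, and the integrals of simple functions in `L^α(m)` converge to `X` in probability
whenever the simple functions converge to `f` in `L^α(m)`. -/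
structure IsStableIntegral {B Ω : Type*} [MeasurableSpace B] [MeasurableSpace Ω] (α : ℝ)
    (m : Measure B) (M : Set B → Ω → ℝ) (P : Measure Ω) (f : B → ℝ) (X : Ω → ℝ) : Prop where
  memLp : MemLp f (ENNReal.ofReal α) m
  aemeasurable : AEMeasurable X P
  tendsto : ∀ s : ℕ → SimpleFunc B ℝ, (∀ n, MemLp (s n) (ENNReal.ofReal α) m) →
    Tendsto (fun n => eLpNorm (⇑(s n) - f) (ENNReal.ofReal α) m) atTop (𝓝 0) →
    TendstoInMeasure P (fun n => simpleIntegral M (s n)) atTop X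

/-- The kernel `(ω', x) ↦ 1_{[0, A_t(ω')]}(x)`, where `[0, a]` means `[a, 0]` if `a < 0`. -/
noncomputable def kernel {Ω' : Type*} (A : ℝ≥0 → Ω' → ℝ) (t : ℝ≥0) : Ω' × ℝ → ℝ :=
  fun p => (Set.uIcc 0 (A t p.1)).indicator (fun _ => (1 : ℝ)) p.2

/-- `Y` is an indicator fractional stable motion: for all `t ≥ 0`, `Y_t` is the stochastic integral
`∫∫ 1_{[0, A_t(ω')]}(x) M(dω', dx)` with respect to `M`, of control measure `P' × Lebesgue`. -/
def IsIndicatorFSM {Ω' Ω : Type*} [MeasurableSpace Ω'] [MeasurableSpace Ω] (α : ℝ)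
    (A : ℝ≥0 → Ω' → ℝ) (P' : Measure Ω') (M : Set (Ω' × ℝ) → Ω → ℝ) (P : Measure Ω)
    (Y : ℝ≥0 → Ω → ℝ) : Prop :=
  ∀ t, IsStableIntegral α (P'.prod volume) M P (kernel A t) (Y t)

end IFSM

namespace IFSM

/-! For almost every point the kernel is the indicator of the region between 0 and A_t, whose
measure is E'|A_t| by Fubini; this is finite because β > 1 (`HasSaSLaw.integrable`). Hence Y(t) is
simply M of that region (`isStableIntegral_indicator`, `ae_eq_of_isStableIntegral`).

A combination ∑ c_i Y(t_i) then has characteristic function exp(-V|θ|^α) (`charFun_sum`), where V is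
the E'-mean of the functional `intervalEnergy` of the vector (A_{t_i}). This gives stability, and by
Cramér–Wold reduces the other claims to two properties of the functional. It is homogeneous of
degree one (`intervalEnergy_mul`), so the factor k^{H'} from A becomes (k^{H'/α})^α. For differences
of kernels it depends only on differences of endpoints (`lintegral_indicator_sub_indicator`), so
stationary increments pass from A to Y. -/

lemma ae_eq_zero_of_charFun_eq_one {Ω : Type*} [MeasurableSpace Ω] {P : Measure Ω}
    [IsProbabilityMeasure P] {X : Ω → ℝ} (hX : AEMeasurable X P)
    (h : ∀ θ, charFun (P.map X) θ = 1) : X =ᵐ[P] 0 := by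
  have := Measure.isProbabilityMeasure_map hX
  have h0 : P.map X = Measure.dirac 0 := by
    apply Measure.ext_of_charFun
    ext θ
    rw [h θ, charFun_dirac]
    simp
  have h1 : ∀ᵐ x ∂(P.map X), x = 0 := by
    rw [h0]
    exact (ae_dirac_iff (p := fun x : ℝ => x = 0) (measurableSet_singleton 0)).2 rfl
  exact ae_of_ae_map hX h1

/-! ### Finite additivity and integrals of simple functions -/

namespace IsSaSRandomMeasure

variable {B Ω : Type*} [MeasurableSpace B] [MeasurableSpace Ω] {α : ℝ} {m : Measure B}
  {M : Set B → Ω → ℝ} {P : Measure Ω}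

lemma ae_empty [IsProbabilityMeasure P] (hM : IsSaSRandomMeasure α m M P) (hα : 0 < α) :
    M ∅ =ᵐ[P] 0 := by
  obtain ⟨h1, h2⟩ := hM.law ∅ MeasurableSet.empty (by simp)
  refine ae_eq_zero_of_charFun_eq_one h1 fun θ => ?_
  rw [h2]
  simp [Real.zero_rpow hα.ne', Real.zero_rpow (inv_ne_zero hα.ne')]

/-- Pad the pair with empty sets, on which M vanishes almost surely, and apply σ-additivity. -/
lemma ae_union [IsProbabilityMeasure P] (hM : IsSaSRandomMeasure α m M P) (hα : 0 < α) {E F : Set B}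
    (hE : MeasurableSet E) (hF : MeasurableSet F) (hEm : m E < ∞) (hFm : m F < ∞)
    (hEF : Disjoint E F) : M (E ∪ F) =ᵐ[P] fun ω => M E ω + M F ω := by
  let G : ℕ → Set B := fun n => if n = 0 then E else if n = 1 then F else ∅
  have hG : ⋃ i, G i = E ∪ F := by
    ext x
    simp only [Set.mem_iUnion, Set.mem_union]
    constructor
    · rintro ⟨i, hi⟩
      simp only [G] at hi
      split_ifs at hi
      · exact Or.inl hi
      · exact Or.inr hi
      · exact hi.elim
    · rintro (h | h)
      · exact ⟨0, by simpa [G] using h⟩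
      · exact ⟨1, by simpa [G] using h⟩
  have hlt : m (⋃ i, G i) < ∞ := by
    rw [hG]
    exact (measure_union_le E F).trans_lt (ENNReal.add_lt_top.2 ⟨hEm, hFm⟩)
  have hmeas : ∀ i, MeasurableSet (G i) := by
    intro i
    simp only [G]
    split_ifs
    exacts [hE, hF, MeasurableSet.empty]
  have hdisj : Pairwise (fun i j => Disjoint (G i) (G j)) := by
    intro i j hij
    simp only [G]
    split_ifs with h1 h2 h3 h4 h5 h6 <;> simp_all [disjoint_comm]
  filter_upwards [hM.sigmaAdditive G hmeas hlt hdisj, hM.ae_empty hα] with ω h1 h2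
  rw [hG] at h1
  have h3 : Tendsto (fun n => ∑ i ∈ Finset.range n, M (G i) ω) atTop (𝓝 (M E ω + M F ω)) := by
    refine tendsto_const_nhds.congr' ?_
    filter_upwards [eventually_ge_atTop 2] with n hn
    obtain ⟨k, rfl⟩ := Nat.exists_eq_add_of_le hn
    rw [Finset.sum_range_add]
    have h3 : ∀ x, M (G (2 + x)) ω = 0 := fun x => by
      simpa [G, show 2 + x ≠ 1 by omega] using h2
    simp only [h3, Finset.sum_const_zero, add_zero]
    simp [Finset.sum_range_succ, G]
  exact tendsto_nhds_unique h1 h3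

lemma ae_preimage_finset [IsProbabilityMeasure P] (hM : IsSaSRandomMeasure α m M P)
    (hα : 0 < α) {κ : Type*}
    (φ : SimpleFunc B κ) (S : Finset κ) (hS : ∀ k ∈ S, m (φ ⁻¹' {k}) < ∞) :
    M (φ ⁻¹' S) =ᵐ[P] fun ω => ∑ k ∈ S, M (φ ⁻¹' {k}) ω := by
  classical
  induction S using Finset.induction_on with
  | empty => filter_upwards [hM.ae_empty hα] with ω h; simpa using h
  | insert k S hk ih =>
    have hS' : ∀ k ∈ S, m (φ ⁻¹' {k}) < ∞ := fun j hj => hS j (Finset.mem_insert_of_mem hj)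
    have hfin : m (φ ⁻¹' S) < ∞ := by
      have : φ ⁻¹' (S : Set κ) = ⋃ k ∈ S, φ ⁻¹' {k} := by
        ext x; simp
      rw [this]
      exact measure_biUnion_lt_top S.finite_toSet hS'
    have hd : Disjoint (φ ⁻¹' {k}) (φ ⁻¹' (S : Set κ)) :=
      Disjoint.preimage _ (by simpa using hk)
    have hu := hM.ae_union hα (φ.measurableSet_fiber k) (φ.measurableSet_preimage S)
      (hS k (Finset.mem_insert_self k S)) hfin hd
    filter_upwards [hu, ih hS'] with ω h1 h2
    rw [Finset.sum_insert hk, ← h2, ← h1, ← Set.preimage_union, Finset.coe_insert,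
      Set.insert_eq]

/-- The integral may be computed on any finer finite partition. Additivity follows by refining both
summands to the partition of `s.pair t`. -/
lemma simpleIntegral_map [IsProbabilityMeasure P] (hM : IsSaSRandomMeasure α m M P)
    (hα : 0 < α) {κ : Type*}
    (φ : SimpleFunc B κ) (g : κ → ℝ) (hg : (φ.map g).FinMeasSupp m) :
    simpleIntegral M (φ.map g) =ᵐ[P] fun ω => ∑ k ∈ φ.range, g k * M (φ ⁻¹' {k}) ω := by
  classical
  rw [SimpleFunc.finMeasSupp_iff] at hg
  have key : ∀ y : ℝ, (fun ω => y * M (φ.map g ⁻¹' {y}) ω) =ᵐ[P]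
      fun ω => ∑ k ∈ φ.range with g k = y, g k * M (φ ⁻¹' {k}) ω := by
    intro y
    -- The zero level may have infinite measure, where M is not additive, but its coefficient
    -- vanishes on both sides.
    by_cases hy : y = 0
    · filter_upwards with ω
      rw [hy, zero_mul]
      refine (Finset.sum_eq_zero fun k hk => ?_).symm
      rw [(Finset.mem_filter.1 hk).2, zero_mul]
    have hS : ∀ k ∈ φ.range.filter (fun k => g k = y), m (φ ⁻¹' {k}) < ∞ := by
      intro k hk
      refine (measure_mono ?_).trans_lt (hg y hy)
      intro x hx
      have hx' : φ x = k := hx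
      simp [hx', (Finset.mem_filter.1 hk).2]
    filter_upwards [hM.ae_preimage_finset hα φ _ hS] with ω h
    rw [SimpleFunc.map_preimage_singleton, h, Finset.mul_sum]
    refine Finset.sum_congr rfl fun k hk => ?_
    rw [(Finset.mem_filter.1 hk).2]
  have key' : ∀ᵐ ω ∂P, ∀ y ∈ (φ.map g).range, y * M (φ.map g ⁻¹' {y}) ω =
      ∑ k ∈ φ.range with g k = y, g k * M (φ ⁻¹' {k}) ω :=
    (ae_ball_iff (φ.map g).range.countable_toSet).2 fun y _ => key y
  filter_upwards [key'] with ω h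
  rw [simpleIntegral, Finset.sum_congr rfl h, SimpleFunc.range_map]
  exact Finset.sum_fiberwise_of_maps_to (fun k hk => Finset.mem_image_of_mem g hk) _

lemma simpleIntegral_add [IsProbabilityMeasure P] (hM : IsSaSRandomMeasure α m M P)
    (hα : 0 < α) {s t : SimpleFunc B ℝ}
    (hs : s.FinMeasSupp m) (ht : t.FinMeasSupp m) :
    simpleIntegral M (s + t) =ᵐ[P] fun ω => simpleIntegral M s ω + simpleIntegral M t ω := by
  have h1 := hM.simpleIntegral_map hα (s.pair t) (fun p => p.1 + p.2) (hs.add ht)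
  have h2 := hM.simpleIntegral_map hα (s.pair t) Prod.fst
    (by rwa [SimpleFunc.map_fst_pair])
  have h3 := hM.simpleIntegral_map hα (s.pair t) Prod.snd
    (by rwa [SimpleFunc.map_snd_pair])
  rw [SimpleFunc.map_fst_pair] at h2
  rw [SimpleFunc.map_snd_pair] at h3
  filter_upwards [h1, h2, h3] with ω e1 e2 e3
  rw [e2, e3, ← Finset.sum_add_distrib, SimpleFunc.add_eq_map₂, e1]
  exact Finset.sum_congr rfl fun k _ => add_mul _ _ _

lemma simpleIntegral_smul [IsProbabilityMeasure P] (hM : IsSaSRandomMeasure α m M P)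
    (hα : 0 < α) (c : ℝ)
    {s : SimpleFunc B ℝ} (hs : s.FinMeasSupp m) :
    simpleIntegral M (c • s) =ᵐ[P] fun ω => c * simpleIntegral M s ω := by
  have h1 := hM.simpleIntegral_map hα s (fun x => c • x) (hs.map (smul_zero c))
  filter_upwards [h1] with ω e1
  rw [SimpleFunc.smul_eq_map, e1, simpleIntegral, Finset.mul_sum]
  exact Finset.sum_congr rfl fun k _ => by rw [smul_eq_mul, mul_assoc]

lemma aemeasurable_simpleIntegral (hM : IsSaSRandomMeasure α m M P)
    {s : SimpleFunc B ℝ} (hs : s.FinMeasSupp m) : AEMeasurable (simpleIntegral M s) P := by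
  refine Finset.aemeasurable_fun_sum _ fun y _ => ?_
  by_cases hy : y = 0
  · simp [hy]
  exact ((hM.law _ (s.measurableSet_fiber y) (SimpleFunc.finMeasSupp_iff.1 hs y hy)).1).const_mul y

/-- Level sets are disjoint, so independence factors the characteristic function; the scale
m(E)^(1/α) raised to α gives back m(E). -/
lemma charFun_simpleIntegral (hM : IsSaSRandomMeasure α m M P) (hα : 0 < α)
    {s : SimpleFunc B ℝ} (hs : s.FinMeasSupp m) (θ : ℝ) :
    charFun (P.map (simpleIntegral M s)) θ =
      ((Real.exp (-((∫⁻ b, ‖s b‖ₑ ^ α ∂m).toReal * |θ| ^ α)) : ℝ) : ℂ) := by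
  classical
  have hfin := SimpleFunc.finMeasSupp_iff.1 hs
  -- The law and independence axioms only cover sets of finite measure, so the zero level is
  -- discarded.
  set R := s.range.filter (· ≠ 0) with hR
  have hne : ∀ y : R, (y : ℝ) ≠ 0 := fun y => (Finset.mem_filter.1 y.2).2
  have hsum : simpleIntegral M s = fun ω => ∑ y : R, (y : ℝ) * M (s ⁻¹' {(y : ℝ)}) ω := by
    ext ω
    rw [Finset.sum_coe_sort R (fun y => y * M (s ⁻¹' {y}) ω), hR, Finset.sum_filter, simpleIntegral]
    refine Finset.sum_congr rfl fun y _ => ?_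
    by_cases hy : y = 0 <;> simp [hy]
  have hlaw : ∀ y : R, HasSaSLaw α (m.real (s ⁻¹' {(y : ℝ)}) ^ (1 / α)) (M (s ⁻¹' {(y : ℝ)})) P :=
    fun y => hM.law _ (s.measurableSet_fiber y) (hfin y (hne y))
  have hind : iIndepFun (fun y : R => M (s ⁻¹' {(y : ℝ)})) P := by
    have h0 := hM.indep (Fintype.card R)
      (fun i => s ⁻¹' {(((Fintype.equivFin R).symm i : R) : ℝ)})
      (fun i => s.measurableSet_fiber _) (fun i => hfin _ (hne _)) (fun i j hij => by
        refine Disjoint.preimage _ (Set.disjoint_singleton.2 fun h => hij ?_)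
        exact (Fintype.equivFin R).symm.injective (Subtype.ext h))
    have h1 := h0.precomp (Fintype.equivFin R).injective
    simpa using h1
  have hind' : iIndepFun (fun (y : R) ω => (y : ℝ) * M (s ⁻¹' {(y : ℝ)}) ω) P :=
    hind.comp (fun (y : R) x => (y : ℝ) * x) fun y => measurable_const_mul _
  have hint : (∫⁻ b, ‖s b‖ₑ ^ α ∂m).toReal =
      ∑ y : R, |(y : ℝ)| ^ α * m.real (s ⁻¹' {(y : ℝ)}) := by
    have e1 : ∫⁻ b, ‖s b‖ₑ ^ α ∂m = ∑ y ∈ s.range, ‖y‖ₑ ^ α * m (s ⁻¹' {y}) := by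
      rw [← SimpleFunc.map_lintegral (fun y : ℝ => ‖y‖ₑ ^ α) s,
        ← SimpleFunc.lintegral_eq_lintegral]
      rfl
    have e2 : ∑ y ∈ s.range, ‖y‖ₑ ^ α * m (s ⁻¹' {y}) = ∑ y ∈ R, ‖y‖ₑ ^ α * m (s ⁻¹' {y}) := by
      rw [hR, Finset.sum_filter]
      refine Finset.sum_congr rfl fun y _ => ?_
      by_cases hy : y = 0 <;> simp [hy, hα]
    rw [e1, e2, ← Finset.sum_coe_sort R (fun y => ‖y‖ₑ ^ α * m (s ⁻¹' {y})), ENNReal.toReal_sum]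
    · refine Finset.sum_congr rfl fun y _ => ?_
      rw [ENNReal.toReal_mul, ← ENNReal.toReal_rpow, toReal_enorm, Real.norm_eq_abs]
      rfl
    · intro y _
      exact ENNReal.mul_ne_top (ENNReal.rpow_ne_top_of_nonneg hα.le enorm_ne_top)
        (hfin y (hne y)).ne
  rw [hsum, hind'.charFun_map_fun_sum_eq_prod fun y => (hlaw y).1.const_mul _, Finset.prod_apply,
    hint, Finset.sum_mul, ← Finset.sum_neg_distrib, Real.exp_sum, Complex.ofReal_prod]
  refine Finset.prod_congr rfl fun y _ => ?_
  rw [charFun_map_mul_comp (hlaw y).1, (hlaw y).2, ← Real.rpow_mul measureReal_nonneg,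
    one_div_mul_cancel hα.ne', Real.rpow_one, abs_mul, Real.mul_rpow (abs_nonneg _) (abs_nonneg _)]
  ring_nf

end IsSaSRandomMeasure

/-! ### Tail bounds and integrability of stable variables -/

/-- Truncation inequality combined with 1 - e^{-u} ≤ u. It serves twice: r → ∞ gives integrability,
v → 0 gives convergence in probability. -/
lemma measureReal_abs_gt_le_of_charFun {μ : Measure ℝ} [IsProbabilityMeasure μ] {α v r : ℝ}
    (hα : 0 ≤ α) (hv : 0 ≤ v) (hr : 0 < r)
    (h : ∀ θ, charFun μ θ = ((Real.exp (-(v * |θ| ^ α)) : ℝ) : ℂ)) :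
    μ.real {x | r < |x|} ≤ 2 * (v * (2 / r) ^ α) := by
  have hb : ‖∫ t in (-2 * r⁻¹)..(2 * r⁻¹), 1 - charFun μ t‖ ≤
      v * (2 / r) ^ α * |2 * r⁻¹ - -2 * r⁻¹| := by
    refine intervalIntegral.norm_integral_le_of_norm_le_const fun θ hθ => ?_
    have hθ' : |θ| ≤ 2 / r := by
      have := Set.uIoc_subset_uIcc hθ
      rw [Set.uIcc_of_le (by rw [neg_mul]; exact neg_le_self (by positivity))] at this
      rw [abs_le, div_eq_mul_inv]
      exact ⟨by linarith [this.1], this.2⟩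
    have h1 : |θ| ^ α ≤ (2 / r) ^ α := Real.rpow_le_rpow (abs_nonneg _) hθ' hα
    have h2 : v * |θ| ^ α ≤ v * (2 / r) ^ α := mul_le_mul_of_nonneg_left h1 hv
    have h3 : 0 ≤ v * |θ| ^ α := by positivity
    rw [h θ, ← Complex.ofReal_one, ← Complex.ofReal_sub, Complex.norm_real, Real.norm_eq_abs,
      abs_of_nonneg (sub_nonneg.2 (Real.exp_le_one_iff.2 (neg_nonpos.2 h3)))]
    linarith [Real.add_one_le_exp (-(v * |θ| ^ α))]
  refine (measureReal_abs_gt_le_integral_charFun hr).trans ?_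
  calc 2⁻¹ * r * ‖∫ t in (-2 * r⁻¹)..(2 * r⁻¹), 1 - charFun μ t‖
      ≤ 2⁻¹ * r * (v * (2 / r) ^ α * |2 * r⁻¹ - -2 * r⁻¹|) := by gcongr
    _ = 2 * (v * (2 / r) ^ α) := by
      rw [abs_of_nonneg (by rw [neg_mul, sub_neg_eq_add]; positivity)]
      field_simp
      ring

/-- The tail is O(r^{-β}), integrable at infinity since β > 1; the layer-cake formula concludes. -/
lemma HasSaSLaw.integrable {Ω : Type*} [MeasurableSpace Ω] {P : Measure Ω}
    [IsProbabilityMeasure P] {β σ : ℝ} {X : Ω → ℝ} (hβ : 1 < β) (hσ : 0 ≤ σ)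
    (h : HasSaSLaw β σ X P) : Integrable X P := by
  have := Measure.isProbabilityMeasure_map h.1
  have htail : ∀ r : ℝ, 0 < r → P {ω | r < |X ω|} ≤
      ENNReal.ofReal (2 * (σ ^ β * 2 ^ β) * r ^ (-β)) := by
    intro r hr
    have h1 := measureReal_abs_gt_le_of_charFun (by linarith) (Real.rpow_nonneg hσ β) hr h.2
    have hm : MeasurableSet {x : ℝ | r < |x|} := measurableSet_lt measurable_const (by fun_prop)
    have h2 : (P.map X) {x | r < |x|} = P {ω | r < |X ω|} :=
      Measure.map_apply_of_aemeasurable h.1 hm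
    rw [← h2, ← ofReal_measureReal]
    refine ENNReal.ofReal_le_ofReal (h1.trans_eq ?_)
    rw [Real.div_rpow zero_le_two hr.le, Real.rpow_neg hr.le]
    ring
  refine ⟨h.1.aestronglyMeasurable, ?_⟩
  rw [hasFiniteIntegral_iff_norm]
  simp only [Real.norm_eq_abs]
  rw [lintegral_eq_lintegral_meas_lt P (ae_of_all _ fun ω => abs_nonneg (X ω)) (by
    exact (continuous_abs.measurable.comp_aemeasurable h.1)),
    ← Set.Ioc_union_Ioi_eq_Ioi zero_le_one]
  refine (lintegral_union_le _ _ _).trans_lt (ENNReal.add_lt_top.2 ⟨?_, ?_⟩)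
  · calc ∫⁻ t in Set.Ioc (0 : ℝ) 1, P {ω | t < |X ω|}
        ≤ ∫⁻ _ in Set.Ioc (0 : ℝ) 1, 1 := lintegral_mono fun t => prob_le_one
      _ < ∞ := by simp
  · calc ∫⁻ t in Set.Ioi (1 : ℝ), P {ω | t < |X ω|}
        ≤ ∫⁻ t in Set.Ioi (1 : ℝ), ENNReal.ofReal (2 * (σ ^ β * 2 ^ β) * t ^ (-β)) :=
          setLIntegral_mono' measurableSet_Ioi fun t ht =>
            htail t (zero_lt_one.trans ht)
      _ < ∞ := ((integrableOn_Ioi_rpow_of_lt (by linarith) one_pos).const_mul _).lintegral_lt_top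

/-! ### The stochastic integral of an indicator -/

section Indicator

variable {B : Type*} [MeasurableSpace B]

/-- The indicator function of a measurable set, as a simple function. -/
noncomputable def simpleIndicator (E : Set B) (hE : MeasurableSet E) : SimpleFunc B ℝ :=
  SimpleFunc.piecewise E hE (SimpleFunc.const B 1) (SimpleFunc.const B 0)

lemma coe_simpleIndicator (E : Set B) (hE : MeasurableSet E) :
    ⇑(simpleIndicator E hE) = E.indicator fun _ => (1 : ℝ) := by
  ext b
  by_cases hb : b ∈ E <;> simp [simpleIndicator, hb]

lemma simpleIndicator_preimage_one (E : Set B) (hE : MeasurableSet E) :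
    simpleIndicator E hE ⁻¹' {1} = E := by
  ext b
  by_cases hb : b ∈ E <;> simp [coe_simpleIndicator, hb]

lemma finMeasSupp_simpleIndicator {m : Measure B} {E : Set B} (hE : MeasurableSet E)
    (hm : m E < ∞) : (simpleIndicator E hE).FinMeasSupp m := by
  rw [SimpleFunc.finMeasSupp_iff_support, coe_simpleIndicator]
  exact (measure_mono Set.support_indicator_subset).trans_lt hm

lemma finMeasSupp_smul {m : Measure B} {s : SimpleFunc B ℝ} (c : ℝ) (hs : s.FinMeasSupp m) :
    (c • s).FinMeasSupp m := by
  rw [SimpleFunc.smul_eq_map]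
  exact hs.map (smul_zero c)

lemma finMeasSupp_sum_smul {m : Measure B} {ι : Type*} (I : Finset ι) (c : ι → ℝ)
    {s : ι → SimpleFunc B ℝ} (hs : ∀ i ∈ I, (s i).FinMeasSupp m) :
    (∑ i ∈ I, c i • s i).FinMeasSupp m := by
  classical
  induction I using Finset.induction_on with
  | empty => simp [SimpleFunc.finMeasSupp_iff_support]
  | insert i I hi ih =>
    rw [Finset.sum_insert hi]
    exact (finMeasSupp_smul _ (hs i (I.mem_insert_self i))).add
      (ih fun j hj => hs j (Finset.mem_insert_of_mem hj))

end Indicator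

namespace IsSaSRandomMeasure

variable {B Ω : Type*} [MeasurableSpace B] [MeasurableSpace Ω] {α : ℝ} {m : Measure B}
  {M : Set B → Ω → ℝ} {P : Measure Ω} [IsProbabilityMeasure P]

lemma simpleIntegral_indicator (hM : IsSaSRandomMeasure α m M P) (hα : 0 < α) {E : Set B}
    (hE : MeasurableSet E) : simpleIntegral M (simpleIndicator E hE) =ᵐ[P] M E := by
  filter_upwards [hM.ae_empty hα] with ω h
  rw [simpleIntegral, Finset.sum_eq_single 1]
  · rw [one_mul, simpleIndicator_preimage_one]
  · intro y hy hy1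
    obtain ⟨b, rfl⟩ := SimpleFunc.mem_range.1 hy
    have : simpleIndicator E hE b = 0 := by
      by_cases hb : b ∈ E <;> simp_all [coe_simpleIndicator]
    rw [this, zero_mul]
  · intro h1
    rw [← SimpleFunc.preimage_eq_empty_iff] at h1
    rw [h1, h, Pi.zero_apply, mul_zero]

lemma simpleIntegral_sum_smul (hM : IsSaSRandomMeasure α m M P) (hα : 0 < α) {ι : Type*}
    (I : Finset ι) (c : ι → ℝ) {s : ι → SimpleFunc B ℝ} (hs : ∀ i ∈ I, (s i).FinMeasSupp m) :
    simpleIntegral M (∑ i ∈ I, c i • s i) =ᵐ[P]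
      fun ω => ∑ i ∈ I, c i * simpleIntegral M (s i) ω := by
  classical
  induction I using Finset.induction_on with
  | empty =>
    filter_upwards with ω
    simp only [Finset.sum_empty]
    refine Finset.sum_eq_zero fun y hy => ?_
    obtain ⟨b, rfl⟩ := SimpleFunc.mem_range.1 hy
    simp
  | insert i I hi ih =>
    have hi' := hs i (I.mem_insert_self i)
    have hI' := fun j hj => hs j (Finset.mem_insert_of_mem hj)
    filter_upwards [ih hI', hM.simpleIntegral_smul hα (c i) hi',
      hM.simpleIntegral_add hα (finMeasSupp_smul (c i) hi') (finMeasSupp_sum_smul I c hI')]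
      with ω h1 h2 h3
    rw [Finset.sum_insert hi, Finset.sum_insert hi, h3, h1, h2]

/-- The error of an approximating simple function is itself a simple integral, stable with scale
tending to 0, so the tail bound applies. -/
lemma isStableIntegral_indicator (hM : IsSaSRandomMeasure α m M P) (hα : 0 < α) {E : Set B}
    (hE : MeasurableSet E) (hm : m E < ∞) {f : B → ℝ}
    (hf : f =ᵐ[m] E.indicator fun _ => (1 : ℝ)) : IsStableIntegral α m M P f (M E) where
  memLp := (memLp_congr_ae hf).2 (memLp_indicator_const _ hE 1 (Or.inr hm.ne))
  aemeasurable := (hM.law E hE hm).1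
  tendsto s hs hlim := by
    have hp : ENNReal.ofReal α ≠ 0 := (ENNReal.ofReal_pos.2 hα).ne'
    set e := simpleIndicator E hE with he
    have hef : e.FinMeasSupp m := finMeasSupp_simpleIndicator hE hm
    have hsf : ∀ n, (s n).FinMeasSupp m := fun n =>
      (SimpleFunc.memLp_iff_finMeasSupp hp ENNReal.ofReal_ne_top).1 (hs n)
    set d : ℕ → SimpleFunc B ℝ := fun n => s n + (-1 : ℝ) • e with hd
    have hdf : ∀ n, (d n).FinMeasSupp m := fun n => (hsf n).add (finMeasSupp_smul _ hef)
    have hdint : ∀ n, simpleIntegral M (d n) =ᵐ[P] fun ω => simpleIntegral M (s n) ω - M E ω := by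
      intro n
      filter_upwards [hM.simpleIntegral_add hα (hsf n) (finMeasSupp_smul (-1) hef),
        hM.simpleIntegral_smul hα (-1) hef, hM.simpleIntegral_indicator hα hE] with ω h1 h2 h3
      rw [h1, h2, h3]
      ring
    have hv : Tendsto (fun n => (∫⁻ b, ‖d n b‖ₑ ^ α ∂m).toReal) atTop (𝓝 0) := by
      have h1 : ∀ n, ∫⁻ b, ‖d n b‖ₑ ^ α ∂m = eLpNorm (⇑(s n) - f) (ENNReal.ofReal α) m ^ α := by
        intro n
        rw [eLpNorm_eq_lintegral_rpow_enorm_toReal hp ENNReal.ofReal_ne_top,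
          ENNReal.toReal_ofReal hα.le, ← ENNReal.rpow_mul, one_div_mul_cancel hα.ne',
          ENNReal.rpow_one]
        refine lintegral_congr_ae ?_
        filter_upwards [hf] with b hb
        simp [hd, he, coe_simpleIndicator, hb, sub_eq_add_neg]
      simp only [h1]
      have h2 := ((ENNReal.continuous_rpow_const (y := α)).tendsto 0).comp hlim
      rw [ENNReal.zero_rpow_of_pos hα] at h2
      exact (ENNReal.tendsto_toReal ENNReal.zero_ne_top).comp h2
    rw [tendstoInMeasure_iff_measureReal_norm]
    intro ε hε
    -- The tail bound concerns a strict inequality, hence the threshold ε / 2.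
    have hbound : ∀ n, P.real {ω | ε ≤ ‖simpleIntegral M (s n) ω - M E ω‖} ≤
        2 * ((∫⁻ b, ‖d n b‖ₑ ^ α ∂m).toReal * (2 / (ε / 2)) ^ α) := by
      intro n
      have hme := hM.aemeasurable_simpleIntegral (hdf n)
      have := Measure.isProbabilityMeasure_map hme
      refine le_trans ?_ (measureReal_abs_gt_le_of_charFun hα.le ENNReal.toReal_nonneg (half_pos hε)
        (hM.charFun_simpleIntegral hα (hdf n)))
      have hms : MeasurableSet {x : ℝ | ε / 2 < |x|} :=
        measurableSet_lt measurable_const (by fun_prop)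
      rw [map_measureReal_apply_of_aemeasurable hme hms]
      refine ENNReal.toReal_mono (measure_ne_top _ _) (measure_mono_ae ?_)
      filter_upwards [hdint n] with ω hω h
      have h' : ε ≤ ‖simpleIntegral M (s n) ω - M E ω‖ := h
      change ε / 2 < |simpleIntegral M (d n) ω|
      rw [hω, ← Real.norm_eq_abs]
      linarith
    refine squeeze_zero (fun n => measureReal_nonneg) hbound ?_
    simpa using (hv.mul_const ((2 / (ε / 2)) ^ α)).const_mul 2

/-- The constant sequence is an admissible approximation, and limits in probability are unique. -/
lemma ae_eq_of_isStableIntegral (hM : IsSaSRandomMeasure α m M P) {E : Set B}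
    (hE : MeasurableSet E) (hm : m E < ∞) {f : B → ℝ}
    (hf : f =ᵐ[m] E.indicator fun _ => (1 : ℝ)) {X : Ω → ℝ} (hX : IsStableIntegral α m M P f X) :
    X =ᵐ[P] simpleIntegral M (simpleIndicator E hE) := by
  have h1 := hX.tendsto (fun _ => simpleIndicator E hE)
    (fun _ => by
      rw [coe_simpleIndicator]; exact memLp_indicator_const _ hE 1 (Or.inr hm.ne))
    (by
      have : ⇑(simpleIndicator E hE) - f =ᵐ[m] 0 := by
        filter_upwards [hf] with b hb
        simp [coe_simpleIndicator, hb]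
      rw [eLpNorm_congr_ae this]
      simp)
  exact tendstoInMeasure_ae_unique h1 (tendstoInMeasure_of_tendsto_ae
    (fun _ => (hM.aemeasurable_simpleIntegral
      (finMeasSupp_simpleIndicator hE hm)).aestronglyMeasurable)
    (ae_of_all _ fun _ => tendsto_const_nhds))

end IsSaSRandomMeasure

/-! ### Scaling and translation of the interval energy -/

/-- The `α`-th power of the `L^α` norm of `∑ i, c i · 1_{[0, a i]}` for Lebesgue measure. -/
noncomputable def intervalEnergy {ι : Type*} [Fintype ι] (α : ℝ) (c a : ι → ℝ) : ℝ≥0∞ :=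
  ∫⁻ x, ‖∑ i, c i * (Set.uIcc 0 (a i)).indicator (fun _ => (1 : ℝ)) x‖ₑ ^ α

lemma measurableSet_snd_mem_uIcc {S : Type*} [MeasurableSpace S] {f : S → ℝ}
    (hf : Measurable f) : MeasurableSet {p : S × ℝ | p.2 ∈ Set.uIcc 0 (f p.1)} := by
  have hf' : Measurable fun p : S × ℝ => f p.1 := hf.comp measurable_fst
  exact (measurableSet_le (measurable_const.min hf') measurable_snd).inter
    (measurableSet_le measurable_snd (measurable_const.max hf'))

section Energy

variable {ι : Type*} [Fintype ι] {α : ℝ}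

lemma measurable_intervalEnergy (c : ι → ℝ) : Measurable (intervalEnergy α c) := by
  refine Measurable.lintegral_prod_right' (f := fun p : (ι → ℝ) × ℝ =>
    ‖∑ i, c i * (Set.uIcc 0 (p.1 i)).indicator (fun _ => (1 : ℝ)) p.2‖ₑ ^ α) ?_
  refine (Measurable.enorm ?_).pow_const α
  refine Finset.measurable_fun_sum _ fun i _ => Measurable.const_mul ?_ (c i)
  exact (Measurable.indicator (measurable_const : Measurable fun _ : (ι → ℝ) × ℝ => (1 : ℝ))
    (measurableSet_snd_mem_uIcc (measurable_pi_apply (X := fun _ : ι => ℝ) i)) :)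

lemma intervalEnergy_mul {k : ℝ} (hk : 0 < k) (c a : ι → ℝ) :
    intervalEnergy α c (fun i => k * a i) = ENNReal.ofReal k * intervalEnergy α c a := by
  have hD : ∀ i x, (Set.uIcc 0 (k * a i)).indicator (fun _ => (1 : ℝ)) (k * x) =
      (Set.uIcc 0 (a i)).indicator (fun _ => (1 : ℝ)) x := by
    intro i x
    have : k * x ∈ Set.uIcc 0 (k * a i) ↔ x ∈ Set.uIcc 0 (a i) := by
      rw [Set.mem_uIcc, Set.mem_uIcc]
      have h0 : 0 ≤ k * x ↔ 0 ≤ x := mul_nonneg_iff_of_pos_left hk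
      have h1 : k * x ≤ 0 ↔ x ≤ 0 := by
        constructor <;> intro h <;> nlinarith
      have h2 : k * x ≤ k * a i ↔ x ≤ a i := mul_le_mul_iff_right₀ hk
      have h3 : k * a i ≤ k * x ↔ a i ≤ x := mul_le_mul_iff_right₀ hk
      rw [h0, h1, h2, h3]
    by_cases hx : x ∈ Set.uIcc 0 (a i)
    · rw [Set.indicator_of_mem hx, Set.indicator_of_mem (this.2 hx)]
    · rw [Set.indicator_of_notMem hx, Set.indicator_of_notMem (mt this.1 hx)]
  have hmap : (volume : Measure ℝ) = ENNReal.ofReal k • Measure.map (k * ·) volume := by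
    conv_lhs => rw [← Real.smul_map_volume_mul_left hk.ne', abs_of_pos hk]
  unfold intervalEnergy
  conv_lhs => rw [hmap]
  rw [lintegral_smul_measure, smul_eq_mul]
  congr 1
  rw [show (fun x : ℝ => k * x) = (Homeomorph.mulLeft₀ k hk.ne').toMeasurableEquiv from rfl,
    lintegral_map_equiv]
  refine lintegral_congr fun x => ?_
  simp only [Homeomorph.toMeasurableEquiv_coe, Homeomorph.coe_mulLeft₀, hD]

/-- The right side is additive in the endpoint, and the sign on the left does not depend on `b`. -/
lemma sign_mul_indicator_uIcc {b x : ℝ} (hx : x ≠ 0) (hb : x ≠ b) :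
    (if x < 0 then -1 else 1) * (Set.uIcc 0 b).indicator (fun _ => (1 : ℝ)) x =
      (if x < b then 1 else 0) - (if x < 0 then 1 else 0) := by
  classical
  rw [Set.indicator_apply, Set.mem_uIcc]
  grind

/-- Up to signs, both integrands are built from 1_{x<b_i} - 1_{x<a}, after translation by `a`. The
signs depend on `x` but not on `i`, so they leave the sum and vanish under the absolute value. -/
lemma lintegral_indicator_sub_indicator (c b : ι → ℝ) (a : ℝ) :
    ∫⁻ x, ‖∑ i, c i * ((Set.uIcc 0 (b i)).indicator (fun _ => (1 : ℝ)) x -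
      (Set.uIcc 0 a).indicator (fun _ => (1 : ℝ)) x)‖ₑ ^ α =
      intervalEnergy α c (fun i => b i - a) := by
  unfold intervalEnergy
  rw [← lintegral_sub_right_eq_self
    (fun x => ‖∑ i, c i * (Set.uIcc 0 (b i - a)).indicator (fun _ => (1 : ℝ)) x‖ₑ ^ α) a]
  refine lintegral_congr_ae ?_
  -- The sign identity fails only at interval endpoints, a finite set.
  have hne : ∀ y : ℝ, ∀ᵐ x : ℝ, x ≠ y := fun y => by
    simp [ae_iff, measure_singleton]
  have hb : ∀ᵐ x : ℝ, ∀ i, x ≠ b i := ae_all_iff.2 fun i => hne _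
  filter_upwards [hne 0, hne a, hb] with x h0 ha hb
  have key : ∀ i, (if x < 0 then -1 else 1) *
      (c i * ((Set.uIcc 0 (b i)).indicator (fun _ => (1 : ℝ)) x -
        (Set.uIcc 0 a).indicator (fun _ => (1 : ℝ)) x)) =
      (if x - a < 0 then -1 else 1) *
        (c i * (Set.uIcc 0 (b i - a)).indicator (fun _ => (1 : ℝ)) (x - a)) := by
    intro i
    have h1 := sign_mul_indicator_uIcc h0 (hb i)
    have h2 := sign_mul_indicator_uIcc h0 ha
    have h3 := sign_mul_indicator_uIcc (sub_ne_zero.2 ha) (mt sub_left_inj.1 (hb i))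
    simp only [sub_lt_sub_iff_right, sub_neg] at h3 ⊢
    linear_combination c i * (h1 - h2 - h3)
  have hsum := Finset.sum_congr (rfl : (Finset.univ : Finset ι) = _) fun i _ => key i
  rw [← Finset.mul_sum, ← Finset.mul_sum] at hsum
  have hn := congrArg (fun y : ℝ => ‖y‖ₑ) hsum
  simp only [enorm_mul] at hn
  have hs : ∀ p : Prop, ∀ [Decidable p], ‖(if p then -1 else 1 : ℝ)‖ₑ = 1 := by
    intro p _
    split_ifs <;> simp
  rw [hs, hs, one_mul, one_mul] at hn
  rw [hn]

end Energy

/-! ### Joint laws through linear combinations -/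

/-- Cramér–Wold; frequency 1 suffices because the coefficients are arbitrary. -/
lemma sameFDD_of_charFun_eq {Ω Ω' T : Type*} [MeasurableSpace Ω] [MeasurableSpace Ω']
    {X : T → Ω → ℝ} {P : Measure Ω} {Y : T → Ω' → ℝ} {Q : Measure Ω'} [IsProbabilityMeasure P]
    [IsProbabilityMeasure Q] (hX : ∀ t, AEMeasurable (X t) P) (hY : ∀ t, AEMeasurable (Y t) Q)
    (h : ∀ (I : Finset T) (c : I → ℝ), charFun (P.map fun ω => ∑ t, c t * X t ω) 1 =
      charFun (Q.map fun ω => ∑ t, c t * Y t ω) 1) : SameFDD X P Y Q := by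
  classical
  intro I
  have hX' : AEMeasurable (fun ω (t : I) => X t ω) P := aemeasurable_pi_lambda _ fun t => hX t
  have hY' : AEMeasurable (fun ω (t : I) => Y t ω) Q := aemeasurable_pi_lambda _ fun t => hY t
  have := Measure.isProbabilityMeasure_map hX'
  have := Measure.isProbabilityMeasure_map hY'
  refine ⟨hX', hY', Measure.ext_of_charFunDual ?_⟩
  ext L
  have hL : ∀ v : I → ℝ, L v = ∑ t, L (Pi.single t 1) * v t := by
    intro v
    conv_lhs => rw [pi_eq_sum_univ' v, map_sum]
    refine Finset.sum_congr rfl fun t _ => ?_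
    rw [map_smul, smul_eq_mul, mul_comm]
  rw [charFunDual_eq_charFun_map_one, charFunDual_eq_charFun_map_one,
    AEMeasurable.map_map_of_aemeasurable (by fun_prop) hX',
    AEMeasurable.map_map_of_aemeasurable (by fun_prop) hY']
  have e := h I fun t => L (Pi.single t 1)
  simpa only [← hL, Function.comp_def] using e

lemma sum_smul_apply {B ι : Type*} [MeasurableSpace B] (I : Finset ι) (c : ι → ℝ)
    (s : ι → SimpleFunc B ℝ) (b : B) : (∑ i ∈ I, c i • s i) b = ∑ i ∈ I, c i * s i b := by
  classical
  induction I using Finset.induction_on with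
  | empty => simp
  | insert i I hi ih =>
    rw [Finset.sum_insert hi, Finset.sum_insert hi, SimpleFunc.add_apply, ih]
    rfl

lemma IsSaSRandomMeasure.charFun_sum {B Ω : Type*} [MeasurableSpace B] [MeasurableSpace Ω] {α : ℝ}
    {m : Measure B} {M : Set B → Ω → ℝ} {P : Measure Ω} [IsProbabilityMeasure P]
    (hM : IsSaSRandomMeasure α m M P) (hα : 0 < α) {ι : Type*} (I : Finset ι) (c : ι → ℝ)
    {s : ι → SimpleFunc B ℝ} (hs : ∀ i ∈ I, (s i).FinMeasSupp m) {X : ι → Ω → ℝ}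
    (hX : ∀ i ∈ I, X i =ᵐ[P] simpleIntegral M (s i)) (θ : ℝ) :
    charFun (P.map fun ω => ∑ i ∈ I, c i * X i ω) θ =
      ((Real.exp (-((∫⁻ b, ‖∑ i ∈ I, c i * s i b‖ₑ ^ α ∂m).toReal * |θ| ^ α)) : ℝ) : ℂ) := by
  have hX' : ∀ᵐ ω ∂P, ∀ i ∈ I, X i ω = simpleIntegral M (s i) ω :=
    (ae_ball_iff I.countable_toSet).2 hX
  have h1 : (fun ω => ∑ i ∈ I, c i * X i ω) =ᵐ[P] simpleIntegral M (∑ i ∈ I, c i • s i) := by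
    filter_upwards [hX', hM.simpleIntegral_sum_smul hα I c hs] with ω e1 e2
    rw [e2]
    exact Finset.sum_congr rfl fun i hi => by rw [e1 i hi]
  rw [Measure.map_congr h1, hM.charFun_simpleIntegral hα (finMeasSupp_sum_smul I c hs)]
  simp only [sum_smul_apply]

/-! ### The indicator fractional stable motion -/

section Motion

variable {Ω' : Type*} [MeasurableSpace Ω'] {P' : Measure Ω'} {A : ℝ≥0 → Ω' → ℝ}

lemma IsSaSProcess.exists_hasSaSLaw {Ω T : Type*} [MeasurableSpace Ω] {α : ℝ} {X : T → Ω → ℝ}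
    {P : Measure Ω} (h : IsSaSProcess α X P) (t : T) : ∃ σ, 0 ≤ σ ∧ HasSaSLaw α σ (X t) P := by
  simpa using h {t} fun _ => 1

/-- The region between `0` and `A t`, for a measurable version of the process `A`. -/
def region (hA : ∀ t, AEMeasurable (A t) P') (t : ℝ≥0) : Set (Ω' × ℝ) :=
  {p | p.2 ∈ Set.uIcc 0 ((hA t).mk (A t) p.1)}

lemma measurableSet_region (hA : ∀ t, AEMeasurable (A t) P') (t : ℝ≥0) :
    MeasurableSet (region hA t) :=
  measurableSet_snd_mem_uIcc (hA t).measurable_mk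

lemma measure_region_lt_top [SFinite P'] (hA : ∀ t, AEMeasurable (A t) P')
    (hint : ∀ t, Integrable (A t) P') (t : ℝ≥0) : P'.prod volume (region hA t) < ∞ := by
  rw [Measure.prod_apply (measurableSet_region hA t)]
  have h : ∀ ω', Prod.mk ω' ⁻¹' region hA t = Set.uIcc 0 ((hA t).mk (A t) ω') := fun ω' => rfl
  simp only [h, Real.volume_interval, sub_zero]
  have h2 := ((hint t).congr (hA t).ae_eq_mk).2
  rw [hasFiniteIntegral_iff_norm] at h2
  exact h2

lemma kernel_ae_eq_indicator_region [SFinite P'] (hA : ∀ t, AEMeasurable (A t) P') (t : ℝ≥0) :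
    kernel A t =ᵐ[P'.prod volume] (region hA t).indicator fun _ => (1 : ℝ) := by
  filter_upwards [Measure.quasiMeasurePreserving_fst.tendsto_ae.eventually (hA t).ae_eq_mk]
    with p hp
  rw [kernel, hp]
  rfl

/-- The indicator of `region hA t`, as a simple function. -/
noncomputable def regionIndicator (hA : ∀ t, AEMeasurable (A t) P') (t : ℝ≥0) :
    SimpleFunc (Ω' × ℝ) ℝ :=
  simpleIndicator (region hA t) (measurableSet_region hA t)

lemma regionIndicator_apply (hA : ∀ t, AEMeasurable (A t) P') (t : ℝ≥0) (ω' : Ω') (x : ℝ) :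
    regionIndicator hA t (ω', x) =
      (Set.uIcc 0 ((hA t).mk (A t) ω')).indicator (fun _ => (1 : ℝ)) x := by
  rw [regionIndicator, coe_simpleIndicator]
  rfl

lemma lintegral_sum_regionIndicator [SFinite P'] (hA : ∀ t, AEMeasurable (A t) P') {α : ℝ}
    {ι : Type*} [Fintype ι] (c : ι → ℝ) (τ : ι → ℝ≥0) :
    ∫⁻ p, ‖∑ i, c i * regionIndicator hA (τ i) p‖ₑ ^ α ∂(P'.prod volume) =
      ∫⁻ ω', intervalEnergy α c (fun i => A (τ i) ω') ∂P' := by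
  rw [lintegral_prod _ (by fun_prop)]
  refine lintegral_congr_ae ?_
  filter_upwards [ae_all_iff.2 fun i => (hA (τ i)).ae_eq_mk] with ω' h
  simp only [regionIndicator_apply, h, intervalEnergy]

lemma lintegral_sum_regionIndicator_sub [SFinite P'] (hA : ∀ t, AEMeasurable (A t) P') {α : ℝ}
    {ι : Type*} [Fintype ι] (c : ι → ℝ) (τ : ι → ℝ≥0) (h : ℝ≥0) :
    ∫⁻ p, ‖∑ i, c i * (regionIndicator hA (τ i) + (-1 : ℝ) • regionIndicator hA h) p‖ₑ ^ α
        ∂(P'.prod volume) =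
      ∫⁻ ω', intervalEnergy α c (fun i => A (τ i) ω' - A h ω') ∂P' := by
  rw [lintegral_prod _ (by fun_prop)]
  refine lintegral_congr_ae ?_
  filter_upwards [ae_all_iff.2 fun i => (hA (τ i)).ae_eq_mk, (hA h).ae_eq_mk] with ω' h1 h2
  rw [← lintegral_indicator_sub_indicator]
  simp only [SimpleFunc.add_apply, SimpleFunc.smul_apply, regionIndicator_apply, h1, h2,
    smul_eq_mul, neg_mul, one_mul, sub_eq_add_neg]

variable {Ω : Type*} [MeasurableSpace Ω] {P : Measure Ω} [IsProbabilityMeasure P]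
  [IsProbabilityMeasure P'] {α H : ℝ} {M : Set (Ω' × ℝ) → Ω → ℝ} {Y : ℝ≥0 → Ω → ℝ}

lemma IsIndicatorFSM.isSaSProcess (hY : IsIndicatorFSM α A P' M P Y) (hα : 0 < α)
    (hA : ∀ t, AEMeasurable (A t) P') (hint : ∀ t, Integrable (A t) P')
    (hM : IsSaSRandomMeasure α (P'.prod volume) M P) : IsSaSProcess α Y P := by
  intro I c
  set V := (∫⁻ p, ‖∑ t ∈ I, c t * regionIndicator hA t p‖ₑ ^ α ∂(P'.prod volume)).toReal with hV
  refine ⟨V ^ (1 / α), Real.rpow_nonneg ENNReal.toReal_nonneg _,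
    Finset.aemeasurable_fun_sum _ fun t _ => (hY t).aemeasurable.const_mul _, fun θ => ?_⟩
  rw [hM.charFun_sum hα I c (s := regionIndicator hA)
    (fun t _ => finMeasSupp_simpleIndicator _ (measure_region_lt_top hA hint t))
    (fun t _ => hM.ae_eq_of_isStableIntegral _ (measure_region_lt_top hA hint t)
      (kernel_ae_eq_indicator_region hA t) (hY t)), ← hV,
    ← Real.rpow_mul ENNReal.toReal_nonneg, one_div_mul_cancel hα.ne', Real.rpow_one]

lemma IsIndicatorFSM.hasStationaryIncrements (hY : IsIndicatorFSM α A P' M P Y) (hα : 0 < α)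
    (hA : ∀ t, AEMeasurable (A t) P') (hint : ∀ t, Integrable (A t) P')
    (hM : IsSaSRandomMeasure α (P'.prod volume) M P) (hinc : HasStationaryIncrements A P') :
    HasStationaryIncrements Y P := by
  have hsupp : ∀ t, (regionIndicator hA t).FinMeasSupp (P'.prod volume) := fun t =>
    finMeasSupp_simpleIndicator _ (measure_region_lt_top hA hint t)
  have hYe : ∀ t, Y t =ᵐ[P] simpleIntegral M (regionIndicator hA t) := fun t =>
    hM.ae_eq_of_isStableIntegral _ (measure_region_lt_top hA hint t)
      (kernel_ae_eq_indicator_region hA t) (hY t)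
  have hdsupp : ∀ t h, (regionIndicator hA t + (-1 : ℝ) • regionIndicator hA h).FinMeasSupp
      (P'.prod volume) := fun t h => (hsupp t).add (finMeasSupp_smul _ (hsupp h))
  have hde : ∀ t h, (fun ω => Y t ω - Y h ω) =ᵐ[P]
      simpleIntegral M (regionIndicator hA t + (-1 : ℝ) • regionIndicator hA h) := by
    intro t h
    filter_upwards [hYe t, hYe h, hM.simpleIntegral_smul hα (-1) (hsupp h),
      hM.simpleIntegral_add hα (hsupp t) (finMeasSupp_smul (-1) (hsupp h))] with ω e1 e2 e3 e4
    rw [e4, e3, e1, e2]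
    ring
  have hmeas : ∀ t h, AEMeasurable (fun ω => Y t ω - Y h ω) P := fun t h =>
    (hY t).aemeasurable.sub (hY h).aemeasurable
  intro h
  refine sameFDD_of_charFun_eq (fun t => hmeas _ _) (fun t => hmeas _ _) fun I c => ?_
  -- The reference increments Y_t - Y_0 use the same formula with shift 0, so A_0 = 0 need not be
  -- known.
  rw [hM.charFun_sum hα Finset.univ c (fun t _ => hdsupp (t + h) h) (fun t _ => hde _ _),
    hM.charFun_sum hα Finset.univ c (fun t _ => hdsupp t 0) (fun t _ => hde _ _),
    lintegral_sum_regionIndicator_sub hA c (fun t : I => (t : ℝ≥0) + h) h,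
    lintegral_sum_regionIndicator_sub hA c (fun t : I => (t : ℝ≥0)) 0]
  -- The mean energy depends only on the joint law of the increments of A.
  have e := ((hinc h I).comp (measurable_intervalEnergy (α := α) c)).lintegral_eq
  simp only [Function.comp_def] at e
  rw [e]

lemma IsIndicatorFSM.isSelfSimilar (hY : IsIndicatorFSM α A P' M P Y) (hα : 0 < α)
    (hA : ∀ t, AEMeasurable (A t) P') (hint : ∀ t, Integrable (A t) P')
    (hM : IsSaSRandomMeasure α (P'.prod volume) M P) (hss : IsSelfSimilar H A P') :
    IsSelfSimilar (H / α) Y P := by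
  have hsupp : ∀ t, (regionIndicator hA t).FinMeasSupp (P'.prod volume) := fun t =>
    finMeasSupp_simpleIndicator _ (measure_region_lt_top hA hint t)
  have hYe : ∀ t, Y t =ᵐ[P] simpleIntegral M (regionIndicator hA t) := fun t =>
    hM.ae_eq_of_isStableIntegral _ (measure_region_lt_top hA hint t)
      (kernel_ae_eq_indicator_region hA t) (hY t)
  intro k hk
  have hk' : (0 : ℝ) < k := hk
  refine sameFDD_of_charFun_eq (fun t => (hY _).aemeasurable)
    (fun t => (hY t).aemeasurable.const_mul _) fun I c => ?_
  have hr : (fun ω => ∑ t : I, c t * ((k : ℝ) ^ (H / α) * Y t ω)) =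
      fun ω => (k : ℝ) ^ (H / α) * ∑ t : I, c t * Y t ω := by
    ext ω
    rw [Finset.mul_sum]
    exact Finset.sum_congr rfl fun t _ => by ring
  have hYm : AEMeasurable (fun ω => ∑ t : I, c t * Y t ω) P :=
    Finset.aemeasurable_fun_sum _ fun t _ => (hY t).aemeasurable.const_mul _
  rw [hr, charFun_map_mul_comp hYm,
    hM.charFun_sum hα Finset.univ c (fun t _ => hsupp (k * t)) (fun t _ => hYe _),
    hM.charFun_sum hα Finset.univ c (fun t _ => hsupp t) (fun t _ => hYe _),
    lintegral_sum_regionIndicator hA c (fun t : I => k * (t : ℝ≥0)),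
    lintegral_sum_regionIndicator hA c (fun t : I => (t : ℝ≥0))]
  have e := ((hss k hk I).comp (measurable_intervalEnergy (α := α) c)).lintegral_eq
  have hkH : 0 < (k : ℝ) ^ H := Real.rpow_pos_of_pos hk' H
  simp only [Function.comp_def, intervalEnergy_mul hkH] at e
  -- On one side k^H leaves the mean energy; on the other, the frequency k^(H/α) enters to the power
  -- α.
  rw [e, lintegral_const_mul' _ _ ENNReal.ofReal_ne_top, ENNReal.toReal_mul,
    ENNReal.toReal_ofReal hkH.le, mul_one, abs_one, Real.one_rpow,
    abs_of_pos (Real.rpow_pos_of_pos hk' _), ← Real.rpow_mul hk'.le, div_mul_cancel₀ _ hα.ne',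
    mul_one, mul_comm]

end Motion

end IFSM

theorem mainTheorem1 {Ω' Ω : Type*} [MeasurableSpace Ω'] [MeasurableSpace Ω]
    (P' : Measure Ω') [IsProbabilityMeasure P'] (P : Measure Ω) [IsProbabilityMeasure P]
    (α β H' : ℝ) (hα₀ : 0 < α) (hα₂ : α ≤ 2) (hβ₁ : 1 < β) (hβ₂ : β ≤ 2)
    (hH₀ : 0 < H') (hH₁ : H' < 1)
    (A : ℝ≥0 → Ω' → ℝ) (hA : IFSM.IsSaSSSSI β H' A P') (hA_nd : IFSM.IsNondegenerate A P')
    (M : Set (Ω' × ℝ) → Ω → ℝ) (hM : IFSM.IsSaSRandomMeasure α (P'.prod volume) M P) :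
    (∃ Y : ℝ≥0 → Ω → ℝ, IFSM.IsIndicatorFSM α A P' M P Y) ∧
    (∀ Y₁ Y₂ : ℝ≥0 → Ω → ℝ, IFSM.IsIndicatorFSM α A P' M P Y₁ →
      IFSM.IsIndicatorFSM α A P' M P Y₂ → ∀ t, Y₁ t =ᵐ[P] Y₂ t) ∧
    (∀ Y : ℝ≥0 → Ω → ℝ, IFSM.IsIndicatorFSM α A P' M P Y →
      IFSM.IsSaSSSSI α (H' / α) Y P) := by
  have hint : ∀ t, Integrable (A t) P' := fun t => by
    obtain ⟨σ, hσ, h⟩ := hA.stable.exists_hasSaSLaw t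
    exact h.integrable hβ₁ hσ
  have hAm : ∀ t, AEMeasurable (A t) P' := fun t => (hint t).aemeasurable
  have hfin := IFSM.measure_region_lt_top hAm hint
  have hker := IFSM.kernel_ae_eq_indicator_region hAm
  refine ⟨⟨fun t => M (IFSM.region hAm t), fun t => hM.isStableIntegral_indicator hα₀
    (IFSM.measurableSet_region hAm t) (hfin t) (hker t)⟩, fun Y₁ Y₂ h₁ h₂ t => ?_, fun Y hY =>
    ⟨hY.isSaSProcess hα₀ hAm hint hM, hY.isSelfSimilar hα₀ hAm hint hM hA.selfSimilar,
      hY.hasStationaryIncrements hα₀ hAm hint hM hA.stationaryIncrements⟩⟩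
  have h := IFSM.measurableSet_region hAm t
  exact (hM.ae_eq_of_isStableIntegral h (hfin t) (hker t) (h₁ t)).trans
    (hM.ae_eq_of_isStableIntegral h (hfin t) (hker t) (h₂ t)).symm
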